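/- A compactum is a compact Hausdorff space, a continuum is a (nonempty) connected compactum, $C(X)$ is the unital C$^*$-algebra of continuous functions $X\to\mathbb{C}$, and a continuous map $f\colon X\to Y$ induces $f^\#\colon C(Y)\to C(X)$, $f^\#(h)=h\circ f$. For a compactum $Y$, an infinite discrete set $I$ and an ultrafilter $\mathcal U$ on $I$, let $p\colon Y\times I\to Y$ and $q\colon Y\times I\to I$ be the projections, with induced maps $\beta p\colon\beta(Y\times I)\to Y$ and $\beta q\colon\beta(Y\times I)\to\beta I$ on Stone–Čech compactifications; the ultracopower is $\sum_{\mathcal U}Y=(\beta q)^{-1}(\mathcal U)$, and $p_{Y,\mathcal U}=\beta p|\sum_{\mathcal U}Y$. A continuous surjection $f\colon X\to Y$ of compacta is co-existential if there are such $I$ and $\mathcal U$ and a continuous surjection $g\colon\sum_{\mathcal U}Y\to X$ with $f\circ g=p_{Y,\mathcal U}$. A compactum (resp. continuum) $Y$ is a co-existentially closed compactum (resp. continuum) if every continuous surjection $X\to Y$ with $X$ a compactum (resp. continuum) is co-existential. Formulas are those of continuous logic in the language of unital C$^*$-algebras: they are built from norms $\|t(\bar x)\|$ of *-polynomials by continuous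 connectives $\mathbb{R}^k\to\mathbb{R}$ and by $\sup$ and $\inf$ over closed balls of radius $r\in\mathbb{N}$ about $0$; a formula is existential if it is a string of $\inf$'s followed by a quantifier-free formula. An embedding (injective unital *-homomorphism) $j\colon A\to B$ of unital C$^*$-algebras is existential if $\varphi(j(\bar a))^B=\varphi(\bar a)^A$ for every existential formula $\varphi$ and every tuple $\bar a$ from $A$. $T_{\mathrm{conn}}$ is the set of sentences $\sigma$ with $\sigma^A=0$ for every abelian C$^*$-algebra $A$ with connected Gelfand spectrum. A model of $T_{\mathrm{conn}}$ (resp. an abelian C$^*$-algebra) is existentially closed if each of its embeddings into a model of $T_{\mathrm{conn}}$ (resp. into an abelian C$^*$-algebra) is existential. Then: (1) A continuous surjection $f\colon X\to Y$ of compacta is co-existential if and only if $f^\#\colon C(Y)\to C(X)$ is an existential embedding. (2) A compactum $Y$ is a co-existentially closed compactum if and only if $C(Y)$ is an existentially closed abelian C$^*$-algebra. (3) A continuum $Y$ is a co-existentially closed continuum if and only if $C(Y)$ is an existentially closed model of $T_{\mathrm{conn}}$; moreover, every existentially closed model of $T_{\mathrm{conn}}$ is isomorphic to $C(Y)$ for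 some co-existentially closed continuum $Y$. -/

import Mathlib

universe u

noncomputable section

namespace CoEx

/-! ### Continuous logic in the signature of unital C*-algebras -/

/-- Terms in the variables `x₀, …, xₙ₋₁`: the *-polynomials with complex coefficients. -/
inductive Term (n : ℕ) : Type
  | var (i : Fin n) : Term n
  | zero : Term n
  | one : Term n
  | add (s t : Term n) : Term n
  | mul (s t : Term n) : Term n
  | smul (c : ℂ) (t : Term n) : Term n
  | star (t : Term n) : Term n

/-- Interpretation of a term in a C*-algebra. -/
def Term.eval {A : Type u} [CStarAlgebra A] {n : ℕ} (a : Fin n → A) : Term n → A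
  | .var i => a i
  | .zero => 0
  | .one => 1
  | .add s t => s.eval a + t.eval a
  | .mul s t => s.eval a * t.eval a
  | .smul c t => c • t.eval a
  | .star t => Star.star (t.eval a)

/-- Formulas with free variables among `x₀, …, xₙ₋₁`: norms of terms, closed under continuous
real connectives of all finite arities and under `sup` and `inf` over the domains of
quantification, the closed balls of radius `r ∈ ℕ` centred at `0`. The quantifiers bind the last
variable. -/
inductive Formula : ℕ → Type
  | norm {n : ℕ} (t : Term n) : Formula n
  | conn {n k : ℕ} (c : C(Fin k → ℝ, ℝ)) (φ : Fin k → Formula n) : Formula n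
  | sup {n : ℕ} (r : ℕ) (φ : Formula (n + 1)) : Formula n
  | inf {n : ℕ} (r : ℕ) (φ : Formula (n + 1)) : Formula n

/-- The real value of a formula at a tuple. (By induction, each formula is bounded on bounded
sets of tuples and the balls are nonempty, so the suprema and infima below are genuine.) -/
def Formula.eval {A : Type u} [CStarAlgebra A] : {n : ℕ} → Formula n → (Fin n → A) → ℝ
  | _, .norm t, a => ‖t.eval a‖
  | _, .conn c φ, a => c fun i => (φ i).eval a
  | _, .sup r φ, a => ⨆ x : Metric.closedBall (0 : A) (r : ℝ), φ.eval (Fin.snoc a (x : A))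
  | _, .inf r φ, a => ⨅ x : Metric.closedBall (0 : A) (r : ℝ), φ.eval (Fin.snoc a (x : A))

/-- Quantifier-free formulas. -/
inductive Formula.IsQuantifierFree : {n : ℕ} → Formula n → Prop
  | norm {n : ℕ} (t : Term n) : IsQuantifierFree (Formula.norm t)
  | conn {n k : ℕ} (c : C(Fin k → ℝ, ℝ)) (φ : Fin k → Formula n)
      (h : ∀ i, IsQuantifierFree (φ i)) : IsQuantifierFree (Formula.conn c φ)

/-- Existential formulas: a string of `inf`s in front of a quantifier-free formula. -/
inductive Formula.IsExistential : {n : ℕ} → Formula n → Prop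
  | qf {n : ℕ} (φ : Formula n) (h : φ.IsQuantifierFree) : IsExistential φ
  | inf {n : ℕ} (r : ℕ) (φ : Formula (n + 1)) (h : IsExistential φ) :
      IsExistential (Formula.inf r φ)

/-- A theory is a set of sentences `σ`, standing for the conditions `σ = 0`. -/
abbrev Theory : Type := Set (Formula 0)

/-- The C*-algebra `A` is a model of the theory `T`. -/
def IsModel (T : Theory) (A : Type u) [CStarAlgebra A] : Prop :=
  ∀ σ ∈ T, σ.eval (Fin.elim0 : Fin 0 → A) = 0

/-- The theory of a class of C*-algebras. -/
def theoryOf (K : (A : Type u) → [CStarAlgebra A] → Prop) : Theory :=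
  {σ | ∀ (A : Type u) [CStarAlgebra A], K A → σ.eval (Fin.elim0 : Fin 0 → A) = 0}

/-- Abelian C*-algebras. -/
def IsAbelian (A : Type u) [CStarAlgebra A] : Prop := ∀ x y : A, x * y = y * x

/-- Connected abelian C*-algebras: the Gelfand spectrum is connected (and nonempty). -/
def IsConnectedAbelian (A : Type u) [CStarAlgebra A] : Prop :=
  IsAbelian A ∧ ConnectedSpace (WeakDual.characterSpace ℂ A)

/-- The theory `T_conn` of connected abelian C*-algebras. -/
def Tconn : Theory := theoryOf.{u} fun A _ => IsConnectedAbelian A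

/-- An embedding of unital C*-algebras (an injective unital *-homomorphism) is existential if it
preserves the values of all existential formulas with parameters in the domain. -/
def IsExistentialEmbedding {A B : Type u} [CStarAlgebra A] [CStarAlgebra B]
    (f : A →⋆ₐ[ℂ] B) : Prop :=
  Function.Injective f ∧
    ∀ (n : ℕ) (φ : Formula n), φ.IsExistential → ∀ a : Fin n → A,
      φ.eval (fun i => f (a i)) = φ.eval a

/-- `A` is existentially closed in the class `K`: it belongs to `K` and each of its embeddings
into a member of `K` is existential. -/
def IsExistentiallyClosedIn (K : (A : Type u) → [CStarAlgebra A] → Prop)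
    (A : Type u) [CStarAlgebra A] : Prop :=
  K A ∧ ∀ (B : Type u) [CStarAlgebra B], K B →
    ∀ f : A →⋆ₐ[ℂ] B, Function.Injective f → IsExistentialEmbedding f

/-- Existentially closed abelian C*-algebras. -/
def IsExistentiallyClosedAbelian (A : Type u) [CStarAlgebra A] : Prop :=
  IsExistentiallyClosedIn (fun B _ => IsAbelian B) A

/-- Existentially closed models of `T_conn`. -/
def IsExistentiallyClosedModelTconn (A : Type u) [CStarAlgebra A] : Prop :=
  IsExistentiallyClosedIn (fun B _ => IsModel Tconn.{u} B) A

/-! ### Ultracopowers and co-existential maps -/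

/-- For discrete `I`, the map `βq : β(X × I) → βI` induced by the second projection, where `βI`
is the space of ultrafilters on `I`. -/
def betaSnd (X I : Type u) [TopologicalSpace X] [TopologicalSpace I] [DiscreteTopology I] :
    StoneCech (X × I) → Ultrafilter I :=
  stoneCechExtend (g := fun z : X × I => (pure z.2 : Ultrafilter I))
    ((continuous_of_discreteTopology (f := (pure : I → Ultrafilter I))).comp continuous_snd)

/-- The ultracopower `∑_𝒰 X`: the fibre of `βq : β(X × I) → βI` over `𝒰`. -/
abbrev Ultracopower (X : Type u) [TopologicalSpace X] {I : Type u} [TopologicalSpace I]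
    [DiscreteTopology I] (U : Ultrafilter I) : Type u :=
  {z : StoneCech (X × I) // betaSnd X I z = U}

/-- The projection `p_{X,𝒰} : ∑_𝒰 X → X`, the restriction of `βp : β(X × I) → βX = X`, where
`p` is the first projection. -/
def ultracopowerProj (X : Type u) [TopologicalSpace X] [CompactSpace X] [T2Space X]
    {I : Type u} [TopologicalSpace I] [DiscreteTopology I] (U : Ultrafilter I) :
    C(Ultracopower X U, X) where
  toFun z := stoneCechExtend (continuous_fst : Continuous (Prod.fst : X × I → X)) z.1
  continuous_toFun :=
    (continuous_stoneCechExtend (continuous_fst : Continuous (Prod.fst : X × I → X))).comp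
      continuous_subtype_val

/-- The map `f : X → Y` is co-existential: there are an ultracopower `∑_𝒰 Y` of `Y`, over an
infinite (discrete) index set, and a continuous surjection `g : ∑_𝒰 Y → X` with
`f ∘ g = p_{Y,𝒰}`. -/
def IsCoexistential {X Y : Type u} [TopologicalSpace X] [TopologicalSpace Y] [CompactSpace Y]
    [T2Space Y] (f : C(X, Y)) : Prop :=
  ∃ (I : Type u) (_ : TopologicalSpace I) (_ : DiscreteTopology I) (_ : Infinite I)
    (U : Ultrafilter I) (g : C(Ultracopower Y U, X)),
    Function.Surjective g ∧ f.comp g = ultracopowerProj Y U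

/-- The compactum `Y` is co-existentially closed. -/
def IsCoexistentiallyClosedCompactum (Y : Type u) [TopologicalSpace Y] [CompactSpace Y]
    [T2Space Y] : Prop :=
  ∀ (X : Type u) [TopologicalSpace X] [CompactSpace X] [T2Space X] (f : C(X, Y)),
    Function.Surjective f → IsCoexistential f

/-- The continuum `Y` is a co-existentially closed continuum. -/
def IsCoexistentiallyClosedContinuum (Y : Type u) [TopologicalSpace Y] [CompactSpace Y]
    [T2Space Y] [ConnectedSpace Y] : Prop :=
  ∀ (X : Type u) [TopologicalSpace X] [CompactSpace X] [T2Space X] [ConnectedSpace X]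
    (f : C(X, Y)), Function.Surjective f → IsCoexistential f

end CoEx

end

open Filter Topology

namespace CoEx

/-! ### Evaluation of terms and formulas -/

/-! Everything rests on (1), and (1) on the fact that `C(∑_𝒰 Y)` behaves as the ultrapower of
`C(Y)`. A continuous function on `β(Y × I)` is a bounded family of slices in `C(Y)`, and the norm of
its restriction to the fibre over `𝒰` is the ultralimit of the norms of the slices
(`tendsto_norm_slice`).

If `f ∘ g = p`, then `p^#` factors as `g^# ∘ f^#`. Embeddings can only lower existential values,
while half of Łoś's theorem shows that `p^#` does not lower them (`le_eval_ultracopowerProj`); so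
`f^#` preserves them. Conversely, an existential `f^#` lets finite pieces of `C(X)` be mapped into
`C(Y)` almost homomorphically, almost isometrically and almost over `C(Y)` (`exists_almost_hom`).
The ultralimit of these maps, along an ultrafilter on the set of finite pieces and tolerances, is an
embedding `C(X) → C(∑_𝒰 Y)` over `C(Y)`, and by Gelfand duality it is `g^#` for a surjection `g` as
required.

Parts (2) and (3) follow because embeddings of abelian algebras are dual to surjections of spectra.
For (3) one also needs that connectedness is axiomatizable: commutativity, `‖1‖ = 1` and the absence
of nontrivial projections are expressed by sentences of `T_conn`, so every model has a connected
spectrum (`isModel_Tconn_iff`). -/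

theorem Term.eval_map {A B : Type u} [CStarAlgebra A] [CStarAlgebra B] (j : A →⋆ₐ[ℂ] B)
    {n : ℕ} (a : Fin n → A) (t : Term n) : t.eval (fun i => j (a i)) = j (t.eval a) := by
  induction t with
  | var i => rfl
  | zero => simp [Term.eval]
  | one => simp [Term.eval]
  | add s t hs ht => simp [Term.eval, hs, ht]
  | mul s t hs ht => simp [Term.eval, hs, ht]
  | smul c t ht => simp [Term.eval, ht]
  | star t ht => simp [Term.eval, ht, map_star]

theorem Formula.IsQuantifierFree.eval_map {A B : Type u} [CStarAlgebra A] [CStarAlgebra B]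
    (j : A →⋆ₐ[ℂ] B) (hj : Function.Injective j) {n : ℕ} {φ : Formula n}
    (hφ : φ.IsQuantifierFree) (a : Fin n → A) :
    φ.eval (fun i => j (a i)) = φ.eval a := by
  induction hφ with
  | norm t =>
    simp only [Formula.eval, Term.eval_map]
    exact NonUnitalStarAlgHom.norm_map j hj _
  | conn c φ h ih => simp only [Formula.eval, ih]

theorem Term.exists_norm_eval_le (A : Type u) [CStarAlgebra A] {n : ℕ} (t : Term n) (R : ℝ) :
    ∃ M : ℝ, 0 ≤ M ∧ ∀ a : Fin n → A, (∀ i, ‖a i‖ ≤ R) → ‖t.eval a‖ ≤ M := by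
  induction t with
  | var i => exact ⟨max R 0, le_max_right _ _, fun a ha => (ha i).trans (le_max_left _ _)⟩
  | zero => exact ⟨0, le_rfl, fun a _ => by simp [Term.eval]⟩
  | one => exact ⟨‖(1 : A)‖, norm_nonneg _, fun a _ => le_rfl⟩
  | add s t hs ht =>
    obtain ⟨M, hM, h⟩ := hs
    obtain ⟨N, hN, k⟩ := ht
    exact ⟨M + N, by positivity, fun a ha => norm_add_le_of_le (h a ha) (k a ha)⟩
  | mul s t hs ht =>
    obtain ⟨M, hM, h⟩ := hs
    obtain ⟨N, hN, k⟩ := ht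
    exact ⟨M * N, by positivity, fun a ha => norm_mul_le_of_le (h a ha) (k a ha)⟩
  | smul c t ht =>
    obtain ⟨N, hN, k⟩ := ht
    refine ⟨‖c‖ * N, by positivity, fun a ha => ?_⟩
    simp only [Term.eval, norm_smul]
    gcongr
    exact k a ha
  | star t ht =>
    obtain ⟨N, hN, k⟩ := ht
    exact ⟨N, hN, fun a ha => by simpa [Term.eval] using k a ha⟩

theorem norm_snoc_le {A : Type u} [CStarAlgebra A] {n : ℕ} {a : Fin n → A} {R r : ℝ}
    (ha : ∀ i, ‖a i‖ ≤ R) (x : Metric.closedBall (0 : A) r) (i : Fin (n + 1)) :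
    ‖(Fin.snoc a (x : A) : Fin (n + 1) → A) i‖ ≤ max R r := by
  refine Fin.lastCases ?_ (fun i => ?_) i
  · simpa using Or.inr (mem_closedBall_zero_iff.mp x.2)
  · simpa using Or.inl (ha i)

/-- A formula is bounded on bounded sets of tuples. -/
theorem Formula.exists_abs_eval_le (A : Type u) [CStarAlgebra A] {n : ℕ} (φ : Formula n) (R : ℝ) :
    ∃ M : ℝ, ∀ a : Fin n → A, (∀ i, ‖a i‖ ≤ R) → |φ.eval a| ≤ M := by
  induction φ generalizing R with
  | norm t =>
    obtain ⟨M, -, h⟩ := t.exists_norm_eval_le A R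
    exact ⟨M, fun a ha => by simpa [Formula.eval] using h a ha⟩
  | @conn n k c φ ih =>
    choose M hM using fun i => ih i R
    -- The values of the `φ i` stay in a compact box, on which the continuous connective is bounded.
    obtain ⟨C, hC⟩ := (isCompact_univ_pi fun i : Fin k =>
      isCompact_Icc (a := -M i) (b := M i)).exists_bound_of_continuousOn c.continuous.continuousOn
    exact ⟨C, fun a ha => hC _ fun i _ => abs_le.mp (hM i a ha)⟩
  | sup r φ ih =>
    obtain ⟨M, hM⟩ := ih (max R r)
    refine ⟨M, fun a ha => ?_⟩
    have hb := fun x => abs_le.mp (hM _ (norm_snoc_le (r := (r : ℝ)) ha x))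
    have : Nonempty (Metric.closedBall (0 : A) (r : ℝ)) := ⟨⟨0, by simp⟩⟩
    refine abs_le.mpr ⟨?_, ciSup_le fun x => (hb x).2⟩
    exact (hb ⟨0, by simp⟩).1.trans
      (le_ciSup (f := fun x : Metric.closedBall (0 : A) (r : ℝ) => φ.eval (Fin.snoc a (x : A)))
        ⟨M, by rintro _ ⟨x, rfl⟩; exact (hb x).2⟩ _)
  | inf r φ ih =>
    obtain ⟨M, hM⟩ := ih (max R r)
    refine ⟨M, fun a ha => ?_⟩
    have hb := fun x => abs_le.mp (hM _ (norm_snoc_le (r := (r : ℝ)) ha x))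
    have : Nonempty (Metric.closedBall (0 : A) (r : ℝ)) := ⟨⟨0, by simp⟩⟩
    refine abs_le.mpr ⟨le_ciInf fun x => (hb x).1, ?_⟩
    exact (ciInf_le (f := fun x : Metric.closedBall (0 : A) (r : ℝ) => φ.eval (Fin.snoc a (x : A)))
        ⟨-M, by rintro _ ⟨x, rfl⟩; exact (hb x).1⟩ _).trans (hb ⟨0, by simp⟩).2

/-- A real `⨆` or `⨅` of an unbounded family takes a default value; this bound is what makes each
quantifier comparable with its instances. -/
theorem Formula.exists_abs_eval_snoc_le {A : Type u} [CStarAlgebra A] {n : ℕ}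
    (φ : Formula (n + 1)) (r : ℕ) (a : Fin n → A) :
    ∃ M : ℝ, ∀ x : Metric.closedBall (0 : A) (r : ℝ), |φ.eval (Fin.snoc a (x : A))| ≤ M := by
  obtain ⟨M, hM⟩ := φ.exists_abs_eval_le A (max ‖a‖ r)
  exact ⟨M, fun x => hM _ (norm_snoc_le (norm_le_pi_norm a) x)⟩

theorem Formula.eval_inf_le {A : Type u} [CStarAlgebra A] {n : ℕ} (φ : Formula (n + 1)) (r : ℕ)
    (a : Fin n → A) {x : A} (hx : ‖x‖ ≤ r) :
    (Formula.inf r φ).eval a ≤ φ.eval (Fin.snoc a x) := by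
  obtain ⟨M, hM⟩ := φ.exists_abs_eval_snoc_le r a
  exact ciInf_le (f := fun x : Metric.closedBall (0 : A) (r : ℝ) => φ.eval (Fin.snoc a (x : A)))
    ⟨-M, by rintro _ ⟨x, rfl⟩; exact (abs_le.mp (hM x)).1⟩ ⟨x, by simpa using hx⟩

theorem Formula.le_eval_sup {A : Type u} [CStarAlgebra A] {n : ℕ} (φ : Formula (n + 1)) (r : ℕ)
    (a : Fin n → A) {x : A} (hx : ‖x‖ ≤ r) :
    φ.eval (Fin.snoc a x) ≤ (Formula.sup r φ).eval a := by
  obtain ⟨M, hM⟩ := φ.exists_abs_eval_snoc_le r a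
  exact le_ciSup (f := fun x : Metric.closedBall (0 : A) (r : ℝ) => φ.eval (Fin.snoc a (x : A)))
    ⟨M, by rintro _ ⟨x, rfl⟩; exact (abs_le.mp (hM x)).2⟩ ⟨x, by simpa using hx⟩

theorem Formula.exists_of_eval_inf_lt {A : Type u} [CStarAlgebra A] {n : ℕ}
    {φ : Formula (n + 1)} {r : ℕ} {a : Fin n → A} {c : ℝ} (h : (Formula.inf r φ).eval a < c) :
    ∃ x : A, ‖x‖ ≤ r ∧ φ.eval (Fin.snoc a x) < c := by
  have : Nonempty (Metric.closedBall (0 : A) (r : ℝ)) := ⟨⟨0, by simp⟩⟩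
  obtain ⟨x, hx⟩ := exists_lt_of_ciInf_lt h
  exact ⟨x, mem_closedBall_zero_iff.mp x.2, hx⟩

/-- Values of existential formulas decrease along embeddings. -/
theorem Formula.IsExistential.eval_map_le {A B : Type u} [CStarAlgebra A] [CStarAlgebra B]
    (j : A →⋆ₐ[ℂ] B) (hj : Function.Injective j) {n : ℕ} {φ : Formula n}
    (hφ : φ.IsExistential) (a : Fin n → A) :
    φ.eval (fun i => j (a i)) ≤ φ.eval a := by
  induction hφ with
  | qf φ h => exact (h.eval_map j hj a).le
  | inf r φ h ih =>
    refine le_of_forall_gt fun c hc => ?_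
    obtain ⟨x, hx, hlt⟩ := Formula.exists_of_eval_inf_lt hc
    refine (φ.eval_inf_le r _ (x := j x) ?_).trans_lt (lt_of_le_of_lt ?_ hlt)
    · exact (NonUnitalStarAlgHom.norm_map j hj x).trans_le hx
    · have := ih (Fin.snoc a x)
      rwa [show (fun i => j ((Fin.snoc a x : Fin _ → A) i)) = Fin.snoc (fun i => j (a i)) (j x) from
        Fin.comp_snoc j a x] at this

/-- Isomorphisms are existential embeddings. -/
theorem Formula.IsExistential.eval_equiv {A B : Type u} [CStarAlgebra A] [CStarAlgebra B]
    (e : A ≃⋆ₐ[ℂ] B) {n : ℕ} {φ : Formula n} (hφ : φ.IsExistential) (a : Fin n → A) :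
    φ.eval (fun i => e (a i)) = φ.eval a := by
  refine le_antisymm (hφ.eval_map_le (e : A →⋆ₐ[ℂ] B) e.injective a) ?_
  simpa using hφ.eval_map_le (e.symm : B →⋆ₐ[ℂ] A) e.symm.injective fun i => e (a i)

/-- The formula `inf_{‖x₀‖ ≤ r} ⋯ inf_{‖xₖ₋₁‖ ≤ r} φ`. -/
def Formula.infs {n : ℕ} (r : ℕ) : (k : ℕ) → Formula (n + k) → Formula n
  | 0, φ => φ
  | k + 1, φ => Formula.infs r k (Formula.inf r φ)

theorem Formula.isExistential_infs {n : ℕ} (r k : ℕ) {φ : Formula (n + k)}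
    (h : φ.IsExistential) : (Formula.infs r k φ).IsExistential := by
  induction k with
  | zero => exact h
  | succ k ih => exact ih (.inf r φ h)

theorem Formula.eval_infs_le {A : Type u} [CStarAlgebra A] {n : ℕ} (r k : ℕ)
    (φ : Formula (n + k)) (a : Fin n → A) (x : Fin k → A) (hx : ∀ i, ‖x i‖ ≤ r) :
    (Formula.infs r k φ).eval a ≤ φ.eval (Fin.append a x) := by
  induction k with
  | zero => exact (congrArg φ.eval (by ext i; simp [Fin.append_right_nil])).le
  | succ k ih =>
    refine (ih (Formula.inf r φ) (fun i => x i.castSucc) fun i => hx _).trans ?_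
    refine (φ.eval_inf_le r _ (hx (Fin.last k))).trans_eq ?_
    rw [← Fin.append_snoc]
    exact congrArg (fun y => φ.eval (Fin.append a y)) (Fin.snoc_init_self x)

theorem Formula.exists_of_eval_infs_lt {A : Type u} [CStarAlgebra A] {n : ℕ} {r k : ℕ}
    {φ : Formula (n + k)} {a : Fin n → A} {c : ℝ} (h : (Formula.infs r k φ).eval a < c) :
    ∃ x : Fin k → A, φ.eval (Fin.append a x) < c := by
  induction k with
  | zero =>
    exact ⟨Fin.elim0, by
      rwa [show (Fin.append a Fin.elim0 : Fin (n + 0) → A) = a by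
        ext i; simp [Fin.append_right_nil]]⟩
  | succ k ih =>
    obtain ⟨x, hx⟩ := ih h
    obtain ⟨y, -, hy⟩ := Formula.exists_of_eval_inf_lt hx
    exact ⟨Fin.snoc x y, by rwa [Fin.append_snoc]⟩

/-- If `j : A → B` is existential, then finitely many norms of terms in elements of `B` and
parameters from `A` can be approximated in `A`. -/
theorem IsExistentialEmbedding.exists_approx {A B : Type u} [CStarAlgebra A] [CStarAlgebra B]
    {j : A →⋆ₐ[ℂ] B} (hj : IsExistentialEmbedding j) {n m : ℕ} (a : Fin n → A) (b : Fin m → B)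
    {τ : Type*} [Finite τ] (t : τ → Term (n + m)) {ε : ℝ} (hε : 0 < ε) :
    ∃ x : Fin m → A, ∀ s,
      |‖(t s).eval (Fin.append a x)‖ - ‖(t s).eval (Fin.append (fun i => j (a i)) b)‖| < ε := by
  obtain ⟨k, ⟨e⟩⟩ := Finite.exists_equiv_fin τ
  let v : Fin k → ℝ := fun s => ‖(t (e.symm s)).eval (Fin.append (fun i => j (a i)) b)‖
  -- The connective is the ℓ¹ distance from the vector of norms to its target `v`. The tuple `b`
  -- gives the value 0, so the infimum is at most 0 in `B`, hence also in `A`.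
  let φ : Formula (n + m) :=
    .conn ⟨fun w : Fin k → ℝ => ∑ s, |w s - v s|, by fun_prop⟩ fun s => .norm (t (e.symm s))
  have hφ : φ.IsExistential := .qf _ (.conn _ _ fun _ => .norm _)
  obtain ⟨r, hr⟩ := exists_nat_ge ‖b‖
  have hB : (Formula.infs r m φ).eval (fun i => j (a i)) ≤ 0 := by
    refine (Formula.eval_infs_le r m φ _ b fun i => (norm_le_pi_norm b i).trans hr).trans_eq ?_
    simp [φ, Formula.eval, v]
  rw [hj.2 n _ (Formula.isExistential_infs r m hφ)] at hB
  obtain ⟨x, hx⟩ := Formula.exists_of_eval_infs_lt (hB.trans_lt hε)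
  refine ⟨x, fun s => lt_of_le_of_lt ?_ hx⟩
  have := Finset.single_le_sum (f := fun i => |‖(t (e.symm i)).eval (Fin.append a x)‖ - v i|)
    (fun i _ => abs_nonneg _) (Finset.mem_univ (e s))
  simpa [φ, Formula.eval, v] using this

/-! ### Continuous functions on the ultracopower -/

section Ultracopower

variable {Y I : Type u} [TopologicalSpace Y] [TopologicalSpace I] [DiscreteTopology I]

theorem continuous_betaSnd : Continuous (betaSnd Y I) :=
  continuous_stoneCechExtend _

theorem betaSnd_stoneCechUnit (z : Y × I) : betaSnd Y I (stoneCechUnit z) = pure z.2 :=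
  stoneCechExtend_stoneCechUnit _ z

theorem isClosed_betaSnd_fiber (U : Ultrafilter I) : IsClosed {z | betaSnd Y I z = U} :=
  isClosed_singleton.preimage continuous_betaSnd

instance (U : Ultrafilter I) : CompactSpace (Ultracopower Y U) :=
  isCompact_iff_compactSpace.mp (isClosed_betaSnd_fiber U).isCompact

/-- The `i`-th slice of a function on `β(Y × I)`. -/
noncomputable def slice {Y I : Type u} [TopologicalSpace Y] [TopologicalSpace I] (i : I) :
    C(StoneCech (Y × I), ℂ) →⋆ₐ[ℂ] C(Y, ℂ) :=
  ContinuousMap.compStarAlgHom' ℂ ℂ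
    ⟨fun y => stoneCechUnit (y, i), continuous_stoneCechUnit.comp (by fun_prop)⟩

@[simp]
theorem slice_apply {Y I : Type u} [TopologicalSpace Y] [TopologicalSpace I] (i : I)
    (F : C(StoneCech (Y × I), ℂ)) (y : Y) :
    slice i F y = F (stoneCechUnit (y, i)) := rfl

/-- Restriction of functions on `β(Y × I)` to the ultracopower. -/
noncomputable def restrictFiber (U : Ultrafilter I) :
    C(StoneCech (Y × I), ℂ) →⋆ₐ[ℂ] C(Ultracopower Y U, ℂ) :=
  ContinuousMap.compStarAlgHom' ℂ ℂ ⟨Subtype.val, continuous_subtype_val⟩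

/-- Functions on the ultracopower extend to `β(Y × I)` with the same norm. -/
theorem exists_restrictFiber_eq (U : Ultrafilter I) (x : C(Ultracopower Y U, ℂ)) :
    ∃ F : C(StoneCech (Y × I), ℂ), ‖F‖ = ‖x‖ ∧ restrictFiber U F = x := by
  have : CompactSpace {z | betaSnd Y I z = U} := inferInstanceAs (CompactSpace (Ultracopower Y U))
  -- Tietze extension from the closed fibre, in its norm-preserving form.
  obtain ⟨G, hG, h⟩ := BoundedContinuousFunction.exists_norm_eq_domRestrict_eq
    (isClosed_betaSnd_fiber (Y := Y) U) ℂ (BoundedContinuousFunction.mkOfCompact x)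
  refine ⟨G.toContinuousMap, ?_, ?_⟩
  · rw [← BoundedContinuousFunction.norm_mkOfCompact x, ← hG]
    rfl
  · ext z
    exact DFunLike.congr_fun h z

/-- Bounded families of functions on `Y` are families of slices. -/
theorem exists_slice_eq (u : I → C(Y, ℂ)) (M : ℝ) (hM : ∀ i y, ‖u i y‖ ≤ M) :
    ∃ F : C(StoneCech (Y × I), ℂ), ∀ i, slice i F = u i := by
  -- The common bound `M` gives a compact target, so that the family extends to `β(Y × I)`. Joint
  -- continuity is clear since `I` is discrete.
  let v : Y × I → Metric.closedBall (0 : ℂ) M := fun z => ⟨u z.2 z.1, by simpa using hM z.2 z.1⟩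
  have hv : Continuous v := by
    refine Continuous.subtype_mk ?_ _
    refine continuous_iff_continuousAt.mpr fun ⟨y, i⟩ => ?_
    have h : (fun z : Y × I => u z.2 z.1) =ᶠ[𝓝 (y, i)] fun z => u i z.1 := by
      have : ∀ᶠ z : Y × I in 𝓝 (y, i), z.2 = i :=
        (continuous_snd.tendsto (y, i)).eventually
          (show ∀ᶠ k in 𝓝 i, k = i by simp [nhds_discrete])
      filter_upwards [this] with z hz
      rw [hz]
    exact ContinuousAt.congr (by fun_prop) h.symm
  have : CompactSpace (Metric.closedBall (0 : ℂ) M) :=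
    isCompact_iff_compactSpace.mp (isCompact_closedBall _ _)
  refine ⟨⟨fun z => (stoneCechExtend hv z).1,
    continuous_subtype_val.comp (continuous_stoneCechExtend hv)⟩, fun i => ?_⟩
  ext y
  exact congrArg Subtype.val (stoneCechExtend_stoneCechUnit hv (y, i))

variable [CompactSpace Y]

/-- The norm of a function on the ultracopower is the ultralimit of the norms of the slices. -/
theorem tendsto_norm_slice (U : Ultrafilter I) (F : C(StoneCech (Y × I), ℂ)) :
    Tendsto (fun i => ‖slice i F‖) U (𝓝 ‖restrictFiber U F‖) := by
  rw [tendsto_order]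
  constructor
  · intro c hc
    by_contra hcon
    have hS : {i | ‖slice i F‖ ≤ c} ∈ U := by
      have h := Ultrafilter.eventually_not.mpr hcon
      simp only [not_lt] at h
      exact h
    have hc0 : 0 ≤ c := by
      obtain ⟨i, hi⟩ := U.neBot.nonempty_of_mem hS
      exact (norm_nonneg _).trans hi
    refine hc.not_ge ((ContinuousMap.norm_le _ hc0).mpr fun z => ?_)
    by_contra! hz
    -- The point `z` of the fibre lies in an open set on which `‖F‖ > c` and whose image in `βI`
    -- consists of ultrafilters containing `{i | ‖slice i F‖ ≤ c}`. By density that set contains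
    -- some `(y, i)`, which is absurd.
    obtain ⟨⟨y, i⟩, hi, hlt⟩ := denseRange_stoneCechUnit.exists_mem_open
      (((ultrafilter_isOpen_basic {i | ‖slice i F‖ ≤ c}).preimage continuous_betaSnd).inter
        (isOpen_lt continuous_const F.continuous.norm))
      ⟨z.1, by simpa [z.2] using hS, hz⟩
    rw [Set.mem_preimage, betaSnd_stoneCechUnit] at hi
    exact (((slice i F).norm_coe_le_norm y).trans hi).not_gt hlt
  · intro c hc
    obtain ⟨d, hd, hdc⟩ := exists_between hc
    have hK : IsClosed {z | d ≤ ‖F z‖} := isClosed_le continuous_const F.continuous.norm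
    -- The set where `‖F‖ ≥ d` misses the fibre, so its compact image in `βI` misses a neighbourhood
    -- of `U`, and thus the principal ultrafilters at `U`-almost all `i`.
    have hU : U ∉ betaSnd Y I '' {z | d ≤ ‖F z‖} := by
      rintro ⟨z, hz, hzU⟩
      exact (((restrictFiber U F).norm_coe_le_norm ⟨z, hzU⟩).trans_lt hd).not_ge hz
    have ho := (hK.isCompact.image continuous_betaSnd).isClosed.isOpen_compl.mem_nhds hU
    filter_upwards [U.tendsto_pure_self ho] with i hi
    refine lt_of_le_of_lt ((ContinuousMap.norm_le _ ((norm_nonneg _).trans hd.le)).mpr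
      fun y => ?_) hdc
    by_contra! hy
    exact hi ⟨stoneCechUnit (y, i), hy.le, betaSnd_stoneCechUnit _⟩

theorem tendsto_eval_slice (U : Ultrafilter I) {n : ℕ} {φ : Formula n} (hφ : φ.IsQuantifierFree)
    (F : Fin n → C(StoneCech (Y × I), ℂ)) :
    Tendsto (fun i => φ.eval fun k => slice i (F k)) U
      (𝓝 (φ.eval fun k => restrictFiber U (F k))) := by
  induction hφ with
  | norm t =>
    simp only [Formula.eval, Term.eval_map]
    exact tendsto_norm_slice U _
  | conn c φ h ih =>
    exact (c.continuous.tendsto _).comp (tendsto_pi_nhds.mpr fun k => ih k)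

/-- One half of Łoś's theorem for existential formulas. -/
theorem eventually_eval_slice_lt (U : Ultrafilter I) {n : ℕ} {φ : Formula n}
    (hφ : φ.IsExistential) (F : Fin n → C(StoneCech (Y × I), ℂ)) {c : ℝ}
    (hc : (φ.eval fun k => restrictFiber U (F k)) < c) :
    ∀ᶠ i in U, (φ.eval fun k => slice i (F k)) < c := by
  induction hφ with
  | qf φ h => exact (tendsto_eval_slice U h F).eventually_lt_const hc
  | inf r φ h ih =>
    obtain ⟨x, hx, hlt⟩ := Formula.exists_of_eval_inf_lt hc
    -- The extension has the norm of `x`, so all its slices stay in the ball of radius `r` and are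
    -- admissible witnesses.
    obtain ⟨G, hG, rfl⟩ := exists_restrictFiber_eq U x
    have key := ih (Fin.snoc F G) (by
      rwa [show (fun k => restrictFiber U ((Fin.snoc F G : Fin _ → _) k)) =
        Fin.snoc (fun k => restrictFiber U (F k)) (restrictFiber U G) from
        Fin.comp_snoc (restrictFiber U) F G])
    filter_upwards [key] with i hi
    rw [show (fun k => slice i ((Fin.snoc F G : Fin _ → C(StoneCech (Y × I), ℂ)) k)) =
      Fin.snoc (fun k => slice i (F k)) (slice i G) from Fin.comp_snoc (slice i) F G] at hi
    refine (φ.eval_inf_le r _ ?_).trans_lt hi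
    exact (NonUnitalStarAlgHom.norm_apply_le (slice i) G).trans (hG.trans_le hx)

variable [T2Space Y]

/-- Pulling `a` back along `βp` gives functions on `β(Y × I)` all of whose slices are `a`; Łoś's
inequality then compares the two values. -/
theorem le_eval_ultracopowerProj (U : Ultrafilter I) {n : ℕ} {φ : Formula n}
    (hφ : φ.IsExistential) (a : Fin n → C(Y, ℂ)) :
    φ.eval a ≤ φ.eval fun k => (ultracopowerProj Y U).compStarAlgHom' ℂ ℂ (a k) := by
  refine le_of_forall_gt fun c hc => ?_
  let F : Fin n → C(StoneCech (Y × I), ℂ) := fun k => (a k).comp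
    ⟨_, continuous_stoneCechExtend (continuous_fst : Continuous (Prod.fst : Y × I → Y))⟩
  obtain ⟨i, hi⟩ := (eventually_eval_slice_lt U hφ F hc).exists
  have hF : (fun k => slice i (F k)) = a := by
    ext k y
    simp [F, stoneCechExtend_stoneCechUnit]
  rwa [hF] at hi

end Ultracopower

/-! ### Gelfand duality -/

theorem exists_apply_ne {Y : Type u} [TopologicalSpace Y] [CompactSpace Y] [T2Space Y]
    {s : Set Y} (hs : IsClosed s) {y : Y} (hy : y ∉ s) :
    ∃ h : C(Y, ℂ), h y = 1 ∧ ∀ z ∈ s, h z = 0 := by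
  obtain ⟨h, h0, h1, -⟩ := exists_continuous_zero_one_of_isClosed hs (isClosed_singleton (x := y))
    (by simpa using hy)
  exact ⟨⟨fun z => (h z : ℂ), by fun_prop⟩, by simp [h1 rfl], fun z hz => by simp [h0 hz]⟩

theorem eq_of_forall_apply_eq {Y : Type u} [TopologicalSpace Y] [CompactSpace Y] [T2Space Y]
    {y z : Y} (h : ∀ k : C(Y, ℂ), k y = k z) : y = z := by
  by_contra hne
  obtain ⟨k, h1, h0⟩ := exists_apply_ne (isClosed_singleton (x := z)) (y := y) hne
  simp [h k, h0 z rfl] at h1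

theorem injective_compStarAlgHom' {X Y : Type u} [TopologicalSpace X] [TopologicalSpace Y]
    {f : C(X, Y)} (hf : Function.Surjective f) :
    Function.Injective (f.compStarAlgHom' ℂ ℂ) := by
  intro h k hk
  ext y
  obtain ⟨x, rfl⟩ := hf y
  exact DFunLike.congr_fun hk x

/-- Injective unital *-homomorphisms `C(X) → C(Z)` come from continuous surjections `Z → X`. -/
theorem exists_compStarAlgHom'_eq {X Z : Type u} [TopologicalSpace X] [CompactSpace X] [T2Space X]
    [TopologicalSpace Z] [CompactSpace Z]
    (Φ : C(X, ℂ) →⋆ₐ[ℂ] C(Z, ℂ)) (hΦ : Function.Injective Φ) :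
    ∃ g : C(Z, X), Function.Surjective g ∧ Φ = g.compStarAlgHom' ℂ ℂ := by
  let e := WeakDual.CharacterSpace.homeoEval X ℂ
  -- A point `z` gives the character `h ↦ Φ h z` of `C(X)`, which is evaluation at a unique point `g
  -- z`.
  let g : C(Z, X) := (e.symm : C(_, X)).comp
    ((WeakDual.CharacterSpace.compContinuousMap Φ).comp
      (WeakDual.CharacterSpace.continuousMapEval Z ℂ))
  have hg : ∀ (h : C(X, ℂ)) (z : Z), h (g z) = Φ h z := fun h z =>
    DFunLike.congr_fun (e.apply_symm_apply (WeakDual.CharacterSpace.compContinuousMap Φ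
      (WeakDual.CharacterSpace.continuousMapEval Z ℂ z))) h
  refine ⟨g, fun x => ?_, ?_⟩
  · by_contra hx
    -- A point outside the closed range of `g` would give a nonzero `h` vanishing on that range,
    -- that is, in the kernel of `Φ`.
    obtain ⟨h, h1, h0⟩ := exists_apply_ne (isCompact_range g.continuous).isClosed (y := x)
      (by simpa using hx)
    have : h = 0 := hΦ (by
      ext z
      rw [← hg, h0 _ ⟨z, rfl⟩]
      simp)
    simp [this] at h1
  · ext h z
    exact (hg h z).symm

/-- A map preserving the norms of the basic *-polynomials is an injective *-homomorphism. -/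
theorem exists_starAlgHom {A B : Type u} [CStarAlgebra A] [CStarAlgebra B] (Φ : A → B)
    (hlin : ∀ (c : ℂ) (p q s : A), ‖c • Φ p + Φ q - Φ s‖ = ‖c • p + q - s‖)
    (hmul : ∀ p q s : A, ‖Φ p * Φ q - Φ s‖ = ‖p * q - s‖)
    (hstar : ∀ p s : A, ‖star (Φ p) - Φ s‖ = ‖star p - s‖) (hone : Φ 1 = 1) :
    ∃ Ψ : A →⋆ₐ[ℂ] B, (∀ p, Ψ p = Φ p) ∧ Function.Injective Ψ := by
  have hl : ∀ (c : ℂ) (p q : A), Φ (c • p + q) = c • Φ p + Φ q := fun c p q => by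
    -- With `s` chosen as the true result, the right-hand norm is 0, so the left-hand one vanishes
    -- too.
    have := hlin c p q (c • p + q)
    rwa [sub_self, norm_zero, norm_eq_zero, sub_eq_zero, eq_comm] at this
  have hm : ∀ p q : A, Φ (p * q) = Φ p * Φ q := fun p q => by
    have := hmul p q (p * q)
    rwa [sub_self, norm_zero, norm_eq_zero, sub_eq_zero, eq_comm] at this
  have hs : ∀ p : A, Φ (star p) = star (Φ p) := fun p => by
    have := hstar p (star p)
    rwa [sub_self, norm_zero, norm_eq_zero, sub_eq_zero, eq_comm] at this
  have ha : ∀ p q : A, Φ (p + q) = Φ p + Φ q := fun p q => by simpa using hl 1 p q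
  have h0 : Φ 0 = 0 := by simpa using ha 0 0
  have hsm : ∀ (c : ℂ) (p : A), Φ (c • p) = c • Φ p := fun c p => by simpa [h0] using hl c p 0
  refine ⟨{ toFun := Φ, map_one' := hone, map_mul' := hm, map_zero' := h0, map_add' := ha,
            commutes' := fun c => ?_, map_star' := hs }, fun p => rfl, fun p q hpq => ?_⟩
  · simp [Algebra.algebraMap_eq_smul_one, hsm, hone]
  · have := hlin 1 p 0 q
    rw [show Φ p = Φ q from hpq, h0] at this
    simpa [sub_eq_zero, eq_comm] using this

/-! ### Co-existential maps and existential embeddings -/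

/-- A squeeze: `f^#` and `g^#` can only lower existential values, and their composite `p^#` does not
lower them. -/
theorem IsCoexistential.isExistentialEmbedding {X Y : Type u} [TopologicalSpace X]
    [CompactSpace X] [T2Space X] [TopologicalSpace Y] [CompactSpace Y] [T2Space Y] {f : C(X, Y)}
    (hf : Function.Surjective f) (h : IsCoexistential f) :
    IsExistentialEmbedding (f.compStarAlgHom' ℂ ℂ) := by
  obtain ⟨I, _, _, _, U, g, hg, hfg⟩ := h
  refine ⟨injective_compStarAlgHom' hf, fun n φ hφ a => le_antisymm
    (hφ.eval_map_le _ (injective_compStarAlgHom' hf) a) ?_⟩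
  refine (le_eval_ultracopowerProj U hφ a).trans ?_
  rw [← hfg]
  exact hφ.eval_map_le _ (injective_compStarAlgHom' hg) fun i => f.compStarAlgHom' ℂ ℂ (a i)

/-- The term `s - t`. -/
noncomputable def Term.sub {n : ℕ} (s t : Term n) : Term n := .add s (.smul (-1) t)

@[simp]
theorem Term.eval_sub {A : Type u} [CStarAlgebra A] {n : ℕ} (a : Fin n → A) (s t : Term n) :
    (s.sub t).eval a = s.eval a - t.eval a := by
  simp [Term.sub, Term.eval, sub_eq_add_neg]

/-- If `j : A → B` is existential, then finite pieces of `B` can be mapped into `A` almost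
*-homomorphically, almost isometrically and almost over `A`. -/
theorem IsExistentialEmbedding.exists_almost_hom {A B : Type u} [CStarAlgebra A] [CStarAlgebra B]
    {j : A →⋆ₐ[ℂ] B} (hj : IsExistentialEmbedding j) (F : Finset B) (G : Finset ℂ) {ε : ℝ}
    (hε : 0 < ε) :
    ∃ h : B → A,
      (∀ c ∈ G, ∀ p ∈ F, ∀ q ∈ F, ∀ s ∈ F, |‖c • h p + h q - h s‖ - ‖c • p + q - s‖| < ε) ∧
      (∀ p ∈ F, ∀ q ∈ F, ∀ s ∈ F, |‖h p * h q - h s‖ - ‖p * q - s‖| < ε) ∧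
      (∀ p ∈ F, ∀ s ∈ F, |‖star (h p) - h s‖ - ‖star p - s‖| < ε) ∧
      (∀ a, j a ∈ F → ‖h (j a) - a‖ < ε) ∧
      ∀ p, ‖h p‖ ≤ ‖p‖ + ε := by
  classical
  let e := F.equivFin
  let N := F.card
  let b : Fin N → B := fun i => e.symm i
  have hb : ∀ (p : B) (hp : p ∈ F), b (e ⟨p, hp⟩) = p := fun p hp => by simp [b]
  -- Parameters are preimages under `j`. The values at elements of `F` outside the range of `j` are
  -- junk and are never used.
  let a : Fin N → A := Function.invFun j ∘ b
  have ha : ∀ (x : A) (hx : j x ∈ F), a (e ⟨j x, hx⟩) = x := fun x hx => by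
    simp only [a, Function.comp_apply, hb]
    exact Function.leftInverse_invFun hj.1 x
  let X : Fin N → Term (N + N) := fun i => .var (Fin.natAdd N i)
  let P : Fin N → Term (N + N) := fun i => .var (Fin.castAdd N i)
  -- Five families of norms are approximated at once: linearity, multiplicativity, involution,
  -- distance to the parameters, and the norms themselves.
  obtain ⟨x, hx⟩ := hj.exists_approx a b
    (τ := (G × Fin N × Fin N × Fin N) ⊕ (Fin N × Fin N × Fin N) ⊕ (Fin N × Fin N) ⊕ Fin N ⊕ Fin N)
    (Sum.elim (fun s => (Term.add (.smul s.1 (X s.2.1)) (X s.2.2.1)).sub (X s.2.2.2))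
      (Sum.elim (fun s => (Term.mul (X s.1) (X s.2.1)).sub (X s.2.2))
      (Sum.elim (fun s => (Term.star (X s.1)).sub (X s.2))
      (Sum.elim (fun s => (X s).sub (P s)) X)))) hε
  simp only [Sum.forall, Sum.elim_inl, Sum.elim_inr, Prod.forall, Term.eval_sub, Term.eval, X, P,
    Fin.append_left, Fin.append_right, Subtype.forall] at hx
  obtain ⟨hlin, hmul, hstar, hpar, hnorm⟩ := hx
  let h : B → A := fun p => if hp : p ∈ F then x (e ⟨p, hp⟩) else 0
  have hh : ∀ (p : B) (hp : p ∈ F), h p = x (e ⟨p, hp⟩) := fun p hp => dif_pos hp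
  refine ⟨h, fun c hc p hp q hq s hs => ?_, fun p hp q hq s hs => ?_, fun p hp s hs => ?_,
    fun y hy => ?_, fun p => ?_⟩
  · rw [hh p hp, hh q hq, hh s hs]
    simpa only [hb] using hlin c hc (e ⟨p, hp⟩) (e ⟨q, hq⟩) (e ⟨s, hs⟩)
  · rw [hh p hp, hh q hq, hh s hs]
    simpa only [hb] using hmul (e ⟨p, hp⟩) (e ⟨q, hq⟩) (e ⟨s, hs⟩)
  · rw [hh p hp, hh s hs]
    simpa only [hb] using hstar (e ⟨p, hp⟩) (e ⟨s, hs⟩)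
  · rw [hh _ hy]
    simpa only [hb, ha, sub_self, norm_zero, sub_zero, abs_norm] using hpar (e ⟨j y, hy⟩)
  · by_cases hp : p ∈ F
    · rw [hh p hp]
      have := (abs_lt.mp (hnorm (e ⟨p, hp⟩))).2
      rw [hb] at this
      linarith
    · simp only [h, dif_neg hp, norm_zero]
      positivity

theorem IsExistentialEmbedding.isCoexistential {X Y : Type u} [TopologicalSpace X]
    [CompactSpace X] [T2Space X] [TopologicalSpace Y] [CompactSpace Y] [T2Space Y] {f : C(X, Y)}
    (h : IsExistentialEmbedding (f.compStarAlgHom' ℂ ℂ)) : IsCoexistential f := by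
  classical
  -- An index is a finite piece of `C(X)`, a finite set of scalars and an `n` encoding the tolerance
  -- `1 / (n + 1)`.
  let I : Type u := Finset C(X, ℂ) × Finset ℂ × ℕ
  let _ : TopologicalSpace I := ⊥
  have : DiscreteTopology I := ⟨rfl⟩
  -- This ultrafilter contains every cone `{k | i ≤ k}`, so any prescribed finite set of elements
  -- and scalars is covered by `U`-almost all indices.
  let U : Ultrafilter I := Ultrafilter.of atTop
  have hU : ∀ i : I, ∀ᶠ k in U, i ≤ k := fun i => Ultrafilter.of_le atTop (eventually_ge_atTop i)
  let ε : I → ℝ := fun i => 1 / (i.2.2 + 1)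
  have hε : ∀ i, 0 < ε i := fun i => by positivity
  have hε1 : ∀ i, ε i ≤ 1 := fun i => by
    simp only [ε]
    rw [div_le_one (by positivity)]
    simp
  have hε0 : Tendsto ε U (𝓝 0) := by
    refine Tendsto.mono_left ?_ (Ultrafilter.of_le atTop)
    refine tendsto_one_div_add_atTop_nhds_zero_nat.comp ?_
    rw [← prod_atTop_atTop_eq, ← prod_atTop_atTop_eq]
    exact tendsto_snd.comp tendsto_snd
  choose m hlin hmul hstar hpar hnorm using fun i : I => h.exists_almost_hom i.1 i.2.1 (hε i)
  -- Tolerances at most 1 bound the family `m i p` by `‖p‖ + 1` uniformly in `i`, so it is the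
  -- family of slices of one function `E p`.
  choose E hE using fun p : C(X, ℂ) => exists_slice_eq (fun i => m i p) (‖p‖ + 1) fun i y =>
    ((m i p).norm_coe_le_norm y).trans ((hnorm i p).trans (by gcongr; exact hε1 i))
  -- Since the tolerances tend to 0 along `U`, approximate norm identities on slices become exact on
  -- the ultracopower.
  have hlim : ∀ (T : C(StoneCech (Y × I), ℂ)) (v : ℝ),
      (∀ᶠ i in U, |‖slice i T‖ - v| < ε i) → ‖restrictFiber U T‖ = v := fun T v hT => by
    refine tendsto_nhds_unique (tendsto_norm_slice U T) (tendsto_iff_dist_tendsto_zero.mpr ?_)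
    exact squeeze_zero' (.of_forall fun _ => dist_nonneg)
      (hT.mono fun i hi => by rw [Real.dist_eq]; exact hi.le) hε0
  have hpar' : ∀ a : C(Y, ℂ),
      restrictFiber U (E (f.compStarAlgHom' ℂ ℂ a)) =
        (ultracopowerProj Y U).compStarAlgHom' ℂ ℂ a := fun a => by
    let T : C(StoneCech (Y × I), ℂ) := a.comp
      ⟨_, continuous_stoneCechExtend (continuous_fst : Continuous (Prod.fst : Y × I → Y))⟩
    have hT : ∀ i, slice i T = a := fun i => by
      ext y
      simp [T, stoneCechExtend_stoneCechUnit]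
    have := hlim (E (f.compStarAlgHom' ℂ ℂ a) - T) 0 (by
      filter_upwards [hU ({f.compStarAlgHom' ℂ ℂ a}, ∅, 0)] with i hi
      rw [map_sub, hE, hT, sub_zero, abs_norm]
      exact hpar i a (hi.1 (by simp)))
    rw [norm_eq_zero, map_sub, sub_eq_zero] at this
    exact this
  obtain ⟨Ψ, hΨ, hinj⟩ := exists_starAlgHom (fun p => restrictFiber U (E p))
    (fun c p q s => by
      rw [← map_smul, ← map_add, ← map_sub]
      refine hlim _ _ ?_
      filter_upwards [hU ({p, q, s}, {c}, 0)] with i hi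
      rw [map_sub, map_add, map_smul, hE, hE, hE]
      exact hlin i c (hi.2.1 (by simp)) p (hi.1 (by simp)) q (hi.1 (by simp)) s (hi.1 (by simp)))
    (fun p q s => by
      rw [← map_mul, ← map_sub]
      refine hlim _ _ ?_
      filter_upwards [hU ({p, q, s}, ∅, 0)] with i hi
      rw [map_sub, map_mul, hE, hE, hE]
      exact hmul i p (hi.1 (by simp)) q (hi.1 (by simp)) s (hi.1 (by simp)))
    (fun p s => by
      rw [← map_star, ← map_sub]
      refine hlim _ _ ?_
      filter_upwards [hU ({p, s}, ∅, 0)] with i hi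
      rw [map_sub, map_star, hE, hE]
      exact hstar i p (hi.1 (by simp)) s (hi.1 (by simp)))
    -- The unit of `C(X)` is the image of the parameter `1` of `C(Y)`.
    (by simpa using hpar' 1)
  obtain ⟨g, hg, rfl⟩ := exists_compStarAlgHom'_eq Ψ hinj
  refine ⟨I, inferInstance, inferInstance, inferInstance, U, g, hg, ?_⟩
  ext z
  -- Functions separate points of `Y`, so `f ∘ g = p` reduces to `g^# (f^# k) = p^# k`, which is
  -- `hpar'`.
  refine eq_of_forall_apply_eq fun k => ?_
  exact DFunLike.congr_fun ((hΨ (f.compStarAlgHom' ℂ ℂ k)).trans (hpar' k)) z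

/-! ### Models of `T_conn` -/

theorem IsAbelian.nonempty_equiv {A : Type u} [CStarAlgebra A] (h : IsAbelian A) :
    Nonempty (A ≃⋆ₐ[ℂ] C(WeakDual.characterSpace ℂ A, ℂ)) :=
  let _ : CommCStarAlgebra A := { ‹CStarAlgebra A› with mul_comm := fun x y => h x y }
  ⟨gelfandStarTransform A⟩

theorem norm_equiv {A B : Type u} [CStarAlgebra A] [CStarAlgebra B] (e : A ≃⋆ₐ[ℂ] B) (x : A) :
    ‖e x‖ = ‖x‖ :=
  NonUnitalStarAlgHom.norm_map (e : A →⋆ₐ[ℂ] B) e.injective x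

theorem isConnectedAbelian_continuousMap (Y : Type u) [TopologicalSpace Y] [CompactSpace Y]
    [T2Space Y] [ConnectedSpace Y] : IsConnectedAbelian C(Y, ℂ) :=
  ⟨mul_comm, (WeakDual.CharacterSpace.homeoEval Y ℂ).surjective.connectedSpace
    (WeakDual.CharacterSpace.homeoEval Y ℂ).continuous⟩

/-- The sentence `sup_{‖x‖ ≤ r} sup_{‖y‖ ≤ r} ‖xy - yx‖`. -/
noncomputable def commutatorSentence (r : ℕ) : Formula 0 :=
  .sup r (.sup r (.norm ((Term.mul (.var 0) (.var 1)).sub (.mul (.var 1) (.var 0)))))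

/-- The sentence `|‖1‖ - 1|`. -/
noncomputable def nontrivialSentence : Formula 0 :=
  .conn ⟨fun v : Fin 1 → ℝ => |v 0 - 1|, by fun_prop⟩ fun _ => .norm .one

/-- The sentence expressing that every `x` in the unit ball with `‖x² - x‖ < 1/4` satisfies
`‖x‖ ≤ 1/2` or `‖1 - x‖ ≤ 1/2`. -/
noncomputable def projectionlessSentence : Formula 0 :=
  .sup 1 (.conn
    ⟨fun v : Fin 3 → ℝ => max 0 (min (1 / 4 - v 0) (min (v 1 - 1 / 2) (v 2 - 1 / 2))),
      by fun_prop⟩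
    ![.norm ((Term.mul (.var 0) (.var 0)).sub (.var 0)), .norm (.var 0),
      .norm (Term.sub .one (.var 0))])

theorem commutatorSentence_mem (r : ℕ) : commutatorSentence r ∈ Tconn.{u} := by
  intro A _ hA
  have h : ∀ x y : A, x * y - y * x = 0 := fun x y => sub_eq_zero.mpr (hA.1 x y)
  simp only [commutatorSentence, Formula.eval, Term.eval_sub, Term.eval, h]
  simp

theorem nontrivialSentence_mem : nontrivialSentence ∈ Tconn.{u} := by
  intro A _ hA
  obtain ⟨e⟩ := hA.1.nonempty_equiv
  have := hA.2
  have h1 : ‖(1 : A)‖ = 1 := by rw [← norm_equiv e, map_one, norm_one]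
  simp [nontrivialSentence, Formula.eval, Term.eval, h1]

/-- Pointwise `‖x‖ ‖1 - x‖ < 1/4` excludes `Re x = 1/2`, where both factors are at least `1/2`. By
connectedness `Re x` stays on one side of `1/2`; there one factor is always at least `1/2`, which
keeps the other below `1/2`. -/
theorem norm_le_or_norm_one_sub_le {Z : Type u} [TopologicalSpace Z] [CompactSpace Z]
    [PreconnectedSpace Z] (x : C(Z, ℂ)) (hx : ‖x * x - x‖ < 1 / 4) :
    ‖x‖ ≤ 1 / 2 ∨ ‖1 - x‖ ≤ 1 / 2 := by
  have hlt : ∀ z, ‖x z‖ * ‖1 - x z‖ < 1 / 4 := fun z => by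
    have := ((x * x - x).norm_coe_le_norm z).trans_lt hx
    rwa [show (x * x - x) z = -(x z * (1 - x z)) by simp; ring, norm_neg, norm_mul] at this
  have hre : ∀ z, (x z).re ≤ ‖x z‖ := fun z => Complex.re_le_norm _
  have hre' : ∀ z, 1 - (x z).re ≤ ‖1 - x z‖ := fun z => by simpa using Complex.re_le_norm (1 - x z)
  have hne : ∀ z, (x z).re ≠ 1 / 2 := fun z hz => by
    nlinarith [hlt z, hre z, hre' z]
  have hcont : Continuous fun z => (x z).re := Complex.continuous_re.comp x.continuous
  have hclopen : IsClopen {z | (x z).re < 1 / 2} := by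
    refine ⟨?_, isOpen_lt hcont continuous_const⟩
    rw [show {z | (x z).re < 1 / 2} = {z | (x z).re ≤ 1 / 2} by
      ext z
      exact ⟨fun h => le_of_lt (α := ℝ) h, fun h => lt_of_le_of_ne (α := ℝ) h (hne z)⟩]
    exact isClosed_le hcont continuous_const
  rcases isClopen_iff.mp hclopen with h | h
  · right
    refine (ContinuousMap.norm_le _ (by norm_num)).mpr fun z => ?_
    have hz : ¬ (x z).re < 1 / 2 := fun hz => Set.eq_empty_iff_forall_notMem.mp h z hz
    simp only [ContinuousMap.sub_apply, ContinuousMap.one_apply]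
    by_contra! hc
    nlinarith [hlt z, hre z]
  · left
    refine (ContinuousMap.norm_le _ (by norm_num)).mpr fun z => ?_
    have hz : (x z).re < 1 / 2 := Set.eq_univ_iff_forall.mp h z
    by_contra! hc
    nlinarith [hlt z, hre' z]

theorem projectionlessSentence_mem : projectionlessSentence ∈ Tconn.{u} := by
  intro A _ hA
  obtain ⟨e⟩ := hA.1.nonempty_equiv
  have := hA.2
  have key : ∀ x : A,
      max 0 (min (1 / 4 - ‖x * x - x‖) (min (‖x‖ - 1 / 2) (‖1 - x‖ - 1 / 2))) = 0 := fun x => by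
    refine max_eq_left ?_
    by_cases hx : ‖x * x - x‖ < 1 / 4
    · have := norm_le_or_norm_one_sub_le (e x) (by rwa [← map_mul, ← map_sub, norm_equiv])
      rw [← map_one e, ← map_sub, norm_equiv, norm_equiv] at this
      rcases this with h | h
      · exact (min_le_right _ _).trans ((min_le_left _ _).trans (by linarith))
      · exact (min_le_right _ _).trans ((min_le_right _ _).trans (by linarith))
    · exact (min_le_left _ _).trans (by linarith)
  have : ∀ x : A, (Fin.snoc (Fin.elim0 : Fin 0 → A) x : Fin 1 → A) 0 = x := fun x => by
    simp [Fin.snoc]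
  simp only [projectionlessSentence, Formula.eval, ContinuousMap.coe_mk, Matrix.cons_val,
    Term.eval_sub, Term.eval, this, key]
  simp

theorem IsModel.isAbelian {A : Type u} [CStarAlgebra A] (h : IsModel Tconn.{u} A) :
    IsAbelian A := by
  intro x y
  obtain ⟨r, hr⟩ := exists_nat_ge (max ‖x‖ ‖y‖)
  have h1 := (Formula.le_eval_sup _ r _ ((le_max_right _ _).trans hr)).trans
    ((Formula.le_eval_sup _ r _ ((le_max_left _ _).trans hr)).trans_eq
      (h _ (commutatorSentence_mem r)))
  have h0 : (Fin.snoc (Fin.snoc (Fin.elim0 : Fin 0 → A) x : Fin 1 → A) y : Fin 2 → A) = ![x, y] := by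
    ext i
    fin_cases i <;> simp [Fin.snoc]
  rw [h0] at h1
  simpa [Formula.eval, Term.eval, sub_eq_zero] using h1

theorem IsModel.isConnectedAbelian {A : Type u} [CStarAlgebra A] (h : IsModel Tconn.{u} A) :
    IsConnectedAbelian A := by
  refine ⟨h.isAbelian, ?_⟩
  obtain ⟨e⟩ := h.isAbelian.nonempty_equiv
  have h1 : ‖(1 : A)‖ = 1 := by
    have := h _ nontrivialSentence_mem
    simpa [nontrivialSentence, Formula.eval, Term.eval, sub_eq_zero] using this
  -- An empty spectrum would make `A` the zero algebra, with `‖1‖ = 0`.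
  have hne : Nonempty (WeakDual.characterSpace ℂ A) := by
    by_contra hemp
    rw [not_nonempty_iff] at hemp
    rw [← norm_equiv e, Subsingleton.elim (e 1) 0, norm_zero] at h1
    exact zero_ne_one h1
  suffices PreconnectedSpace (WeakDual.characterSpace ℂ A) from { toNonempty := hne }
  refine preconnectedSpace_iff_clopen.mpr fun s hs => ?_
  by_contra! hcon
  obtain ⟨⟨z, hz⟩, hs'⟩ := hcon
  obtain ⟨w, hw⟩ := (Set.ne_univ_iff_exists_notMem s).mp hs'
  -- A nontrivial clopen set yields a projection with `‖q‖ = 1` and `‖1 - q‖ ≥ 1`.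
  let q : C(WeakDual.characterSpace ℂ A, ℂ) :=
    ⟨s.indicator fun _ => 1, hs.continuous_indicator continuous_const⟩
  have hqq : q * q = q := by
    ext v
    by_cases hv : v ∈ s <;> simp [q, hv]
  have hq1 : ‖q‖ ≤ 1 := (ContinuousMap.norm_le _ zero_le_one).mpr fun v => by
    by_cases hv : v ∈ s <;> simp [q, hv]
  have hq2 : 1 ≤ ‖q‖ := by simpa [q, hz] using q.norm_coe_le_norm z
  have hq3 : 1 ≤ ‖1 - q‖ := by simpa [q, hw] using (1 - q).norm_coe_le_norm w
  obtain ⟨p, hpq⟩ : ∃ p, e p = q := e.surjective q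
  rw [← hpq] at hqq hq1 hq2 hq3
  rw [norm_equiv] at hq1 hq2
  rw [← map_one e, ← map_sub, norm_equiv] at hq3
  rw [← map_mul] at hqq
  have hpp : p * p - p = 0 := sub_eq_zero.mpr (e.injective hqq)
  -- At this projection the inner minimum of `projectionlessSentence` is positive, while its
  -- supremum is 0.
  have key := (Formula.le_eval_sup _ 1 _ (by simpa using hq1)).trans_eq
    (h _ projectionlessSentence_mem)
  have hp : (Fin.snoc (Fin.elim0 : Fin 0 → A) p : Fin 1 → A) 0 = p := by simp [Fin.snoc]
  simp only [Formula.eval, ContinuousMap.coe_mk, Matrix.cons_val, Term.eval_sub, Term.eval, hp,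
    hpp, norm_zero] at key
  refine (lt_of_lt_of_le ?_ ((le_max_right _ _).trans key)).false
  exact lt_min (by norm_num) (lt_min (by linarith) (by linarith))

/-- `T_conn` has no models beyond the algebras that define it, so embeddings between its models are
dual to surjections between continua. -/
theorem isModel_Tconn_iff {A : Type u} [CStarAlgebra A] :
    IsModel Tconn.{u} A ↔ IsConnectedAbelian A :=
  ⟨IsModel.isConnectedAbelian, fun h _ hσ => hσ A h⟩

/-! ### Existentially closed algebras -/

theorem IsExistentialEmbedding.of_equiv_comp {A B C : Type u} [CStarAlgebra A] [CStarAlgebra B]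
    [CStarAlgebra C] (e : B ≃⋆ₐ[ℂ] C) {F : A →⋆ₐ[ℂ] B}
    (h : IsExistentialEmbedding ((e : B →⋆ₐ[ℂ] C).comp F)) : IsExistentialEmbedding F :=
  ⟨fun _ _ hxy => h.1 (congrArg e hxy), fun n φ hφ a =>
    (hφ.eval_equiv e fun i => F (a i)).symm.trans (h.2 n φ hφ a)⟩

theorem IsExistentialEmbedding.of_comp_equiv {A B C : Type u} [CStarAlgebra A] [CStarAlgebra B]
    [CStarAlgebra C] (e : A ≃⋆ₐ[ℂ] B) {F : B →⋆ₐ[ℂ] C}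
    (h : IsExistentialEmbedding (F.comp (e : A →⋆ₐ[ℂ] B))) : IsExistentialEmbedding F := by
  refine ⟨fun x y hxy => ?_, fun n φ hφ b => ?_⟩
  · have : e.symm x = e.symm y := h.1 (by simpa using hxy)
    exact e.symm.injective this
  · rw [← hφ.eval_equiv e.symm b, ← h.2 n φ hφ]
    simp

/-- If every continuous surjection from the spectrum of `B` onto `Y` is co-existential, then every
embedding of `C(Y)` into `B` is existential. -/
theorem isExistentialEmbedding_of_forall {Y B : Type u} [TopologicalSpace Y] [CompactSpace Y]
    [T2Space Y] [CStarAlgebra B] (hB : IsAbelian B)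
    (H : ∀ g : C(WeakDual.characterSpace ℂ B, Y), Function.Surjective g → IsCoexistential g)
    (F : C(Y, ℂ) →⋆ₐ[ℂ] B) (hF : Function.Injective F) : IsExistentialEmbedding F := by
  obtain ⟨e⟩ := hB.nonempty_equiv
  refine IsExistentialEmbedding.of_equiv_comp e ?_
  obtain ⟨g, hg, hgF⟩ := exists_compStarAlgHom'_eq 
    ((e : B →⋆ₐ[ℂ] C(WeakDual.characterSpace ℂ B, ℂ)).comp F) (e.injective.comp hF)
  rw [hgF]
  exact (H g hg).isExistentialEmbedding hg

end CoEx

theorem mainTheorem6 :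
    -- the lemma: co-existential maps and existential embeddings
    (∀ (X Y : Type u) [TopologicalSpace X] [CompactSpace X] [T2Space X]
        [TopologicalSpace Y] [CompactSpace Y] [T2Space Y] (f : C(X, Y)),
        Function.Surjective f →
          (CoEx.IsCoexistential f ↔
            CoEx.IsExistentialEmbedding (f.compStarAlgHom' ℂ ℂ))) ∧
    -- co-existentially closed compacta
    (∀ (Y : Type u) [TopologicalSpace Y] [CompactSpace Y] [T2Space Y],
        CoEx.IsCoexistentiallyClosedCompactum Y ↔
          CoEx.IsExistentiallyClosedAbelian C(Y, ℂ)) ∧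
    -- co-existentially closed continua
    (∀ (Y : Type u) [TopologicalSpace Y] [CompactSpace Y] [T2Space Y] [ConnectedSpace Y],
        CoEx.IsCoexistentiallyClosedContinuum Y ↔
          CoEx.IsExistentiallyClosedModelTconn C(Y, ℂ)) ∧
    -- every existentially closed model of `T_conn` comes from a co-existentially closed continuum
    (∀ (A : Type u) [CStarAlgebra A], CoEx.IsExistentiallyClosedModelTconn A →
        ∃ (Y : Type u) (_ : TopologicalSpace Y) (_ : CompactSpace Y) (_ : T2Space Y)
          (_ : ConnectedSpace Y),
          CoEx.IsCoexistentiallyClosedContinuum Y ∧ Nonempty (A ≃⋆ₐ[ℂ] C(Y, ℂ))) := by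
  refine ⟨fun X Y _ _ _ _ _ _ f hf => ⟨fun h => h.isExistentialEmbedding hf,
    fun h => h.isCoexistential⟩, fun Y _ _ _ => ⟨fun h => ⟨mul_comm, fun B _ hB F hF => ?_⟩,
    fun h X _ _ _ f hf => ?_⟩, fun Y _ _ _ _ => ⟨fun h => ⟨?_, fun B _ hB F hF => ?_⟩,
    fun h X _ _ _ _ f hf => ?_⟩, fun A _ hA => ?_⟩
  · exact CoEx.isExistentialEmbedding_of_forall hB (fun g hg => h _ g hg) F hF
  · exact (h.2 C(X, ℂ) (fun x y => mul_comm x y) _ (CoEx.injective_compStarAlgHom' hf)).isCoexistential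
  · exact CoEx.isModel_Tconn_iff.mpr (CoEx.isConnectedAbelian_continuousMap Y)
  · have hB' := CoEx.isModel_Tconn_iff.mp hB
    have := hB'.2
    exact CoEx.isExistentialEmbedding_of_forall hB'.1 (fun g hg => h _ g hg) F hF
  · exact (h.2 _ (CoEx.isModel_Tconn_iff.mpr (CoEx.isConnectedAbelian_continuousMap X)) _
      (CoEx.injective_compStarAlgHom' hf)).isCoexistential
  · have hA' := CoEx.isModel_Tconn_iff.mp hA.1
    have := hA'.2
    obtain ⟨e⟩ := hA'.1.nonempty_equiv
    refine ⟨WeakDual.characterSpace ℂ A, inferInstance, inferInstance, inferInstance,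
      inferInstance, fun X _ _ _ _ f hf => ?_, ⟨e⟩⟩
    -- Existential closedness applies to the embedding `f^# ∘ e` of `A`; the isomorphism `e` is then
    -- cancelled.
    refine (CoEx.IsExistentialEmbedding.of_comp_equiv e (hA.2 _ (CoEx.isModel_Tconn_iff.mpr
      (CoEx.isConnectedAbelian_continuousMap X)) _ ?_)).isCoexistential
    exact (CoEx.injective_compStarAlgHom' hf).comp e.injective
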